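/- Let $\mathbb{DP}$ be the variety of MTL-algebras (prelinear, commutative, bounded, integral residuated lattices $(A,*,\Rightarrow,\sqcap,\sqcup,0,1)$) generated by all drastic product chains, i.e. MTL-chains in which $x*y=0$ if $x,y<1$ and $x*y=\min\{x,y\}$ otherwise. Let $\mathsf{MC}^\top$ be the category whose objects are finite multisets of nonempty finite chains; a morphism $\{C_i\}_{i\in I}\to\{D_j\}_{j\in J}$ is a family of order-preserving surjections $h_i\colon C_i\to D_{j(i)}$, $i\in I$, such that $h_i^{-1}(\max D_{j(i)})=\{\max C_i\}$ whenever $D_{j(i)}$ has more than one element. Let $MC$ be the contravariant functor from finite DP-algebras (with homomorphisms) to $\mathsf{MC}^\top$ that implements the duality between these categories: $MC\,A$ is the multiset of the chains $C_m$, one for each prime filter $m$ of $A$, where $C_m$ is the chain of prime lattice filters of the quotient chain $A/m$ (equivalently, of prime lattice filters of $A$ containing $m$), ordered by reverse inclusion, and homomorphisms act by taking preimages. (Thus the $(i+1)$-element DP-chain, $i\ge 1$, has dual $\{\mathbf i\}$, where $\mathbf i$ is the $i$-element chain.) Write $\uplus$ for disjoint union of multisets and $nC$ for the disjoint union of $n$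 copies of $C$, and let $\mathbf F_k$ be the free DP-algebra over $k$ free generators. (1) $\mathbf F_1$ is finite, $MC\,\mathbf F_1\cong\{\mathbf 1,\mathbf 3,\mathbf 2,\mathbf 1\}$, and hence $\mathbf F_1$ has exactly $2^2\cdot 3\cdot 4=48$ elements. (2) More generally, for every integer $k\ge 0$, put $$a_h=\sum_{i=0}^{h-2}(-1)^i\binom{h-2}{i}(h+1-i)^k\qquad(3\le h\le k+2).$$ Then every $a_h$ is a nonnegative integer, $\mathbf F_k$ is finite, $$MC\,\mathbf F_k\;\cong\;2^k\{\mathbf 1\}\uplus(3^k-2^k)\{\mathbf 2\}\uplus\biguplus_{h=3}^{k+2}a_h\{\mathbf h\},$$ and $$|\mathbf F_k|=2^{2^k}\cdot 3^{3^k-2^k}\cdot\prod_{h=3}^{k+2}(h+1)^{a_h}.$$ -/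

import Mathlib

open CategoryTheory

/-! ### MTL-algebras, terms, drastic product chains, DP-algebras -/

/-- MTL-algebras `(A, *, ⇨, ⊓, ⊔, ⊥, 1)`: prelinear, commutative, bounded, integral residuated
lattices. The top element is the unit `1` of the monoid. -/
class MTLAlgebra (A : Type) extends Lattice A, BoundedOrder A, CommMonoid A, HImp A where
  one_eq_top : (1 : A) = ⊤
  /-- `⇨` is the residuum of `*`. -/
  mul_le_iff : ∀ a b c : A, a * b ≤ c ↔ a ≤ b ⇨ c
  prelinear : ∀ a b : A, (a ⇨ b) ⊔ (b ⇨ a) = 1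

/-- Terms in the signature of MTL-algebras with variables in `α`. -/
inductive DPTerm (α : Type) : Type
  | var : α → DPTerm α
  | mul : DPTerm α → DPTerm α → DPTerm α
  | imp : DPTerm α → DPTerm α → DPTerm α
  | inf : DPTerm α → DPTerm α → DPTerm α
  | sup : DPTerm α → DPTerm α → DPTerm α
  | zero : DPTerm α
  | one : DPTerm α

namespace DPTerm

/-- The value of a term in an MTL-algebra under an assignment of the variables. -/
def eval {α A : Type} [MTLAlgebra A] (v : α → A) : DPTerm α → A
  | var a => v a
  | mul s t => eval v s * eval v t
  | imp s t => eval v s ⇨ eval v t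
  | inf s t => eval v s ⊓ eval v t
  | sup s t => eval v s ⊔ eval v t
  | zero => ⊥
  | one => 1

/-- Substitution of terms for variables. -/
def subst {α β : Type} (σ : α → DPTerm β) : DPTerm α → DPTerm β
  | var a => σ a
  | mul s t => mul (subst σ s) (subst σ t)
  | imp s t => imp (subst σ s) (subst σ t)
  | inf s t => inf (subst σ s) (subst σ t)
  | sup s t => sup (subst σ s) (subst σ t)
  | zero => zero
  | one => one

theorem eval_subst {α β A : Type} [MTLAlgebra A] (σ : α → DPTerm β) (v : β → A)
    (t : DPTerm α) : eval v (subst σ t) = eval (fun a => eval v (σ a)) t := by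
  induction t <;> simp_all [subst, eval]

end DPTerm

/-- Drastic product chains: MTL-chains in which `x * y` is `⊥` if `x, y < 1` and `min x y`
otherwise. -/
structure IsDPChain (C : Type) [MTLAlgebra C] : Prop where
  total : ∀ x y : C, x ≤ y ∨ y ≤ x
  mul_of_lt : ∀ x y : C, x < 1 → y < 1 → x * y = ⊥
  mul_of_not_lt : ∀ x y : C, ¬ (x < 1 ∧ y < 1) → x * y = x ⊓ y

/-- The identity `s = t` holds in all drastic product chains. -/
def DPValid {α : Type} (s t : DPTerm α) : Prop :=
  ∀ (C : Type) [MTLAlgebra C], IsDPChain C → ∀ v : α → C, s.eval v = t.eval v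

/-- DP-algebras: the members of the variety generated by all drastic product chains, that is,
the MTL-algebras that satisfy every identity which holds in all drastic product chains. -/
def IsDPAlgebra (A : Type) [MTLAlgebra A] : Prop :=
  ∀ (n : ℕ) (s t : DPTerm (Fin n)), DPValid s t → ∀ v : Fin n → A, s.eval v = t.eval v

/-- Homomorphisms of MTL-algebras: maps that preserve all operations. -/
@[ext]
structure MTLHom (A B : Type) [MTLAlgebra A] [MTLAlgebra B] where
  toFun : A → B
  map_mul : ∀ x y, toFun (x * y) = toFun x * toFun y
  map_imp : ∀ x y, toFun (x ⇨ y) = toFun x ⇨ toFun y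
  map_inf : ∀ x y, toFun (x ⊓ y) = toFun x ⊓ toFun y
  map_sup : ∀ x y, toFun (x ⊔ y) = toFun x ⊔ toFun y
  map_bot : toFun ⊥ = ⊥
  map_one : toFun 1 = 1

namespace MTLHom

def id (A : Type) [MTLAlgebra A] : MTLHom A A where
  toFun x := x
  map_mul _ _ := rfl
  map_imp _ _ := rfl
  map_inf _ _ := rfl
  map_sup _ _ := rfl
  map_bot := rfl
  map_one := rfl

def comp {A B C : Type} [MTLAlgebra A] [MTLAlgebra B] [MTLAlgebra C]
    (f : MTLHom A B) (g : MTLHom B C) : MTLHom A C where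
  toFun x := g.toFun (f.toFun x)
  map_mul x y := by rw [f.map_mul, g.map_mul]
  map_imp x y := by rw [f.map_imp, g.map_imp]
  map_inf x y := by rw [f.map_inf, g.map_inf]
  map_sup x y := by rw [f.map_sup, g.map_sup]
  map_bot := by rw [f.map_bot, g.map_bot]
  map_one := by rw [f.map_one, g.map_one]

theorem map_eval {α A B : Type} [MTLAlgebra A] [MTLAlgebra B] (f : MTLHom A B) (v : α → A)
    (t : DPTerm α) : f.toFun (t.eval v) = t.eval (fun a => f.toFun (v a)) := by
  induction t <;>
    simp_all [DPTerm.eval, f.map_mul, f.map_imp, f.map_inf, f.map_sup, f.map_bot, f.map_one]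

end MTLHom

/-- Finite DP-algebras. -/
structure FinDPAlg where
  carrier : Type
  [str : MTLAlgebra carrier]
  [fin : Finite carrier]
  isDP : IsDPAlgebra carrier

attribute [instance] FinDPAlg.str FinDPAlg.fin

/-- The category of finite DP-algebras and their homomorphisms. -/
instance : Category FinDPAlg where
  Hom A B := MTLHom A.carrier B.carrier
  id A := MTLHom.id A.carrier
  comp f g := MTLHom.comp f g

/-! ### Free DP-algebras -/

/-- Two terms are identified in the free algebra when the variety satisfies their identity. -/
def freeDPSetoid (α : Type) : Setoid (DPTerm α) where
  r := DPValid
  iseqv :=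
    { refl := fun _ _ _ _ _ => rfl
      symm := fun h C _ hC v => (h C hC v).symm
      trans := fun h h' C _ hC v => (h C hC v).trans (h' C hC v) }

/-- The free DP-algebra over a set `α` of free generators: terms modulo the identities
of the variety of DP-algebras. -/
def FreeDP (α : Type) : Type := Quotient (freeDPSetoid α)

namespace FreeDP

variable {α : Type}

/-- The class of a term. -/
def mk (t : DPTerm α) : FreeDP α := Quotient.mk (freeDPSetoid α) t

/-- The free generators. -/
def of (a : α) : FreeDP α := mk (DPTerm.var a)

theorem mk_eq {s t : DPTerm α} : mk s = mk t ↔ DPValid s t :=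
  ⟨fun h => Quotient.exact h, fun h => Quotient.sound h⟩

instance : Mul (FreeDP α) :=
  ⟨Quotient.map₂ DPTerm.mul fun _ _ h _ _ h' C _ hC v => by
    simp only [DPTerm.eval]; rw [h C hC v, h' C hC v]⟩

instance : HImp (FreeDP α) :=
  ⟨Quotient.map₂ DPTerm.imp fun _ _ h _ _ h' C _ hC v => by
    simp only [DPTerm.eval]; rw [h C hC v, h' C hC v]⟩

instance : Min (FreeDP α) :=
  ⟨Quotient.map₂ DPTerm.inf fun _ _ h _ _ h' C _ hC v => by
    simp only [DPTerm.eval]; rw [h C hC v, h' C hC v]⟩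

instance : Max (FreeDP α) :=
  ⟨Quotient.map₂ DPTerm.sup fun _ _ h _ _ h' C _ hC v => by
    simp only [DPTerm.eval]; rw [h C hC v, h' C hC v]⟩

instance : One (FreeDP α) := ⟨mk DPTerm.one⟩

theorem mk_mul (s t : DPTerm α) : mk s * mk t = mk (s.mul t) := rfl
theorem mk_imp (s t : DPTerm α) : mk s ⇨ mk t = mk (s.imp t) := rfl
theorem mk_inf (s t : DPTerm α) : mk s ⊓ mk t = mk (s.inf t) := rfl
theorem mk_sup (s t : DPTerm α) : mk s ⊔ mk t = mk (s.sup t) := rfl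
theorem mk_one : (1 : FreeDP α) = mk DPTerm.one := rfl

theorem ind {p : FreeDP α → Prop} (h : ∀ t, p (mk t)) (x : FreeDP α) : p x :=
  Quotient.ind h x

/-- The lattice order is `x ≤ y ↔ x ⊔ y = y`. -/
instance : Lattice (FreeDP α) :=
  Lattice.mk'
    (fun a b => by
      induction a using ind; induction b using ind
      exact mk_eq.2 fun C _ _ v => sup_comm _ _)
    (fun a b c => by
      induction a using ind; induction b using ind; induction c using ind
      exact mk_eq.2 fun C _ _ v => sup_assoc _ _ _)
    (fun a b => by
      induction a using ind; induction b using ind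
      exact mk_eq.2 fun C _ _ v => inf_comm _ _)
    (fun a b c => by
      induction a using ind; induction b using ind; induction c using ind
      exact mk_eq.2 fun C _ _ v => inf_assoc _ _ _)
    (fun a b => by
      induction a using ind; induction b using ind
      exact mk_eq.2 fun C _ _ v => sup_inf_self)
    (fun a b => by
      induction a using ind; induction b using ind
      exact mk_eq.2 fun C _ _ v => inf_sup_self)

theorem mk_le {s t : DPTerm α} : mk s ≤ mk t ↔
    ∀ (C : Type) [MTLAlgebra C], IsDPChain C → ∀ v : α → C, s.eval v ≤ t.eval v := by
  rw [← sup_eq_right]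
  refine (mk_eq (s := s.sup t)).trans ?_
  exact ⟨fun h C _ hC v => sup_eq_right.1 (h C hC v), fun h C _ hC v => sup_eq_right.2 (h C hC v)⟩

instance : MTLAlgebra (FreeDP α) where
  top := mk DPTerm.one
  bot := mk DPTerm.zero
  le_top a := by
    induction a using ind
    exact mk_le.2 fun C _ _ v => by
      simp only [DPTerm.eval, MTLAlgebra.one_eq_top]; exact le_top
  bot_le a := by
    induction a using ind
    exact mk_le.2 fun C _ _ v => bot_le
  mul_assoc a b c := by
    induction a using ind; induction b using ind; induction c using ind
    exact mk_eq.2 fun C _ _ v => mul_assoc _ _ _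
  mul_comm a b := by
    induction a using ind; induction b using ind
    exact mk_eq.2 fun C _ _ v => mul_comm _ _
  one_mul a := by
    induction a using ind
    exact mk_eq.2 fun C _ _ v => one_mul _
  mul_one a := by
    induction a using ind
    exact mk_eq.2 fun C _ _ v => mul_one _
  one_eq_top := rfl
  mul_le_iff a b c := by
    induction a using ind; induction b using ind; induction c using ind
    rw [mk_mul, mk_imp, mk_le, mk_le]
    exact ⟨fun h C _ hC v => (MTLAlgebra.mul_le_iff _ _ _).1 (h C hC v),
      fun h C _ hC v => (MTLAlgebra.mul_le_iff _ _ _).2 (h C hC v)⟩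
  prelinear a b := by
    induction a using ind; induction b using ind
    exact mk_eq.2 fun C _ _ v => MTLAlgebra.prelinear _ _

theorem eval_mk {β : Type} (σ : β → DPTerm α) (t : DPTerm β) :
    t.eval (fun b => mk (σ b)) = mk (t.subst σ) := by
  induction t with
  | var a => rfl
  | mul s t hs ht => simp only [DPTerm.eval, hs, ht]; rfl
  | imp s t hs ht => simp only [DPTerm.eval, hs, ht]; rfl
  | inf s t hs ht => simp only [DPTerm.eval, hs, ht]; rfl
  | sup s t hs ht => simp only [DPTerm.eval, hs, ht]; rfl
  | zero => rfl
  | one => rfl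

theorem isDP : IsDPAlgebra (FreeDP α) := by
  intro n s t h v
  have hv : ∀ b, ∃ u, mk u = v b := fun b => Quotient.exists_rep (v b)
  choose σ hσ using hv
  obtain rfl : (fun b => mk (σ b)) = v := funext hσ
  rw [eval_mk, eval_mk]
  refine mk_eq.2 fun C _ hC w => ?_
  rw [DPTerm.eval_subst, DPTerm.eval_subst]
  exact h C hC _

/-- The universal property, which shows that `FreeDP (Fin k)` is indeed the free algebra over
`k` generators in the variety of DP-algebras. -/
theorem universal {k : ℕ} (B : Type) [MTLAlgebra B] (hB : IsDPAlgebra B) (v : Fin k → B) :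
    ∃! f : MTLHom (FreeDP (Fin k)) B, ∀ a, f.toFun (of a) = v a := by
  refine ⟨⟨Quotient.lift (fun t => t.eval v) fun s t h => hB k s t h v, ?_, ?_, ?_, ?_, rfl, rfl⟩,
    fun _ => rfl, ?_⟩
  · intro x y; induction x using ind; induction y using ind; rfl
  · intro x y; induction x using ind; induction y using ind; rfl
  · intro x y; induction x using ind; induction y using ind; rfl
  · intro x y; induction x using ind; induction y using ind; rfl
  · intro g hg
    ext x
    induction x using ind with
    | h t =>
      have h1 : mk t = t.eval (fun a => of a) := by
        have := eval_mk (fun a : Fin k => DPTerm.var a) t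
        have h2 : ∀ u : DPTerm (Fin k), u.subst DPTerm.var = u := by
          intro u; induction u <;> simp_all [DPTerm.subst]
        rw [h2] at this
        exact this.symm
      change g.toFun (mk t) = t.eval v
      rw [h1, g.map_eval]
      congr 1
      funext a
      exact hg a

end FreeDP

/-! ### The category of finite multisets of nonempty finite chains -/

/-- Finite multisets of nonempty finite chains, displayed as finite families
`{C_i : i ∈ ι}`. -/
structure MCTop where
  ι : Type
  [finIdx : Finite ι]
  chain : ι → Type
  [lin : ∀ i, LinearOrder (chain i)]
  [fin : ∀ i, Finite (chain i)]
  [ne : ∀ i, Nonempty (chain i)]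

attribute [instance] MCTop.finIdx MCTop.lin MCTop.fin MCTop.ne

namespace MCTop

/-- Morphisms `C ⟶ D`: for each chain `C_i` an order preserving surjection of `C_i` onto some
chain `D_j` of `D` such that, unless `D_j` is the one-element chain, the preimage of `max D_j`
is `{max C_i}`. -/
@[ext]
structure Hom (C D : MCTop) where
  idx : C.ι → D.ι
  map : ∀ i, C.chain i → D.chain (idx i)
  mono : ∀ i, Monotone (map i)
  surj : ∀ i, Function.Surjective (map i)
  top : ∀ i, ¬ Subsingleton (D.chain (idx i)) →
    map i ⁻¹' {y | IsTop y} = {x | IsTop x}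

instance : Category MCTop where
  Hom := Hom
  id C :=
    { idx := fun i => i
      map := fun _ x => x
      mono := fun _ _ _ h => h
      surj := fun _ x => ⟨x, rfl⟩
      top := fun _ _ => rfl }
  comp {C D E} f g :=
    { idx := fun i => g.idx (f.idx i)
      map := fun i x => g.map (f.idx i) (f.map i x)
      mono := fun i _ _ h => g.mono _ (f.mono i h)
      surj := fun i => (g.surj _).comp (f.surj i)
      top := fun i h => by
        have hD : ¬ Subsingleton (D.chain (f.idx i)) := fun _ =>
          h ((g.surj (f.idx i)).subsingleton)
        rw [← f.top i hD, ← g.top _ h]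
        rfl }

/-- The multiset `{𝐧}` whose only member is the `n`-element chain, for `n > 0`. -/
def single (n : ℕ) (hn : 0 < n) : MCTop where
  ι := Unit
  chain _ := Fin n
  ne _ := ⟨⟨0, hn⟩⟩

/-- The disjoint union `C ⊎ D`. -/
def union (C D : MCTop) : MCTop where
  ι := C.ι ⊕ D.ι
  chain := Sum.elim C.chain D.chain
  lin i := match i with
    | .inl i => C.lin i
    | .inr i => D.lin i
  fin i := match i with
    | .inl i => C.fin i
    | .inr i => D.fin i
  ne i := match i with
    | .inl i => C.ne i
    | .inr i => D.ne i

/-- The disjoint union of the multisets `C h` for `h` in a finite set `s` of numbers. -/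
def biUnion (s : Finset ℕ) (C : ∀ h ∈ s, MCTop) : MCTop where
  ι := Σ h : {h // h ∈ s}, (C h.1 h.2).ι
  finIdx :=
    have : Finite {h // h ∈ s} := Finite.of_fintype _
    inferInstance
  chain p := (C p.1.1 p.1.2).chain p.2

/-- The copower `n C`: the disjoint union of `n` copies of `C`. -/
def copower (n : ℕ) (C : MCTop) : MCTop where
  ι := Fin n × C.ι
  chain p := C.chain p.2

end MCTop

/-! ### The dual of a finite DP-algebra -/

/-- Prime filters of an MTL-algebra: proper upsets containing `1`, closed under `*`, and prime
(equivalently, the quotient is a nontrivial chain). -/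
@[ext]
structure PrimeFilter (A : Type) [MTLAlgebra A] where
  carrier : Set A
  one_mem : 1 ∈ carrier
  up : ∀ {x y}, x ∈ carrier → x ≤ y → y ∈ carrier
  mul_mem : ∀ {x y}, x ∈ carrier → y ∈ carrier → x * y ∈ carrier
  bot_notMem : ⊥ ∉ carrier
  prime : ∀ {x y}, x ⊔ y ∈ carrier → x ∈ carrier ∨ y ∈ carrier

/-- The prime lattice filters of an MTL-algebra `A` that contain a prime filter `m`; these
are the prime lattice filters of the chain `A / m`. -/
@[ext]
structure PrimeLatFilterOver {A : Type} [MTLAlgebra A] (m : PrimeFilter A) where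
  carrier : Set A
  le : m.carrier ⊆ carrier
  up : ∀ {x y}, x ∈ carrier → x ≤ y → y ∈ carrier
  inf_mem : ∀ {x y}, x ∈ carrier → y ∈ carrier → x ⊓ y ∈ carrier
  bot_notMem : ⊥ ∉ carrier
  prime : ∀ {x y}, x ⊔ y ∈ carrier → x ∈ carrier ∨ y ∈ carrier

namespace MTLHom

variable {A B : Type} [MTLAlgebra A] [MTLAlgebra B]

theorem mono (f : MTLHom A B) {x y : A} (h : x ≤ y) : f.toFun x ≤ f.toFun y := by
  rw [← sup_eq_right, ← f.map_sup, sup_eq_right.2 h]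

/-- The preimage of a prime filter. -/
def comapPrime (f : MTLHom A B) (m : PrimeFilter B) : PrimeFilter A where
  carrier := f.toFun ⁻¹' m.carrier
  one_mem := by simpa [f.map_one] using m.one_mem
  up hx h := m.up hx (f.mono h)
  mul_mem hx hy := by
    simp only [Set.mem_preimage, f.map_mul]; exact m.mul_mem hx hy
  bot_notMem := by simpa [f.map_bot] using m.bot_notMem
  prime h := by
    simp only [Set.mem_preimage, f.map_sup] at h; exact m.prime h

/-- The preimage of a prime lattice filter. -/
def comapLat (f : MTLHom A B) (m : PrimeFilter B) (P : PrimeLatFilterOver m) :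
    PrimeLatFilterOver (f.comapPrime m) where
  carrier := f.toFun ⁻¹' P.carrier
  le _ hx := P.le hx
  up hx h := P.up hx (f.mono h)
  inf_mem hx hy := by
    simp only [Set.mem_preimage, f.map_inf]; exact P.inf_mem hx hy
  bot_notMem := by simpa [f.map_bot] using P.bot_notMem
  prime h := by
    simp only [Set.mem_preimage, f.map_sup] at h; exact P.prime h

end MTLHom

/-! Facts on DP-algebras that make the dual well defined. -/

section facts

theorem MTLAlgebra.le_one {A : Type} [MTLAlgebra A] (x : A) : x ≤ 1 := by
  rw [MTLAlgebra.one_eq_top]; exact le_top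

theorem MTLAlgebra.imp_mul_le {A : Type} [MTLAlgebra A] (x y : A) : (x ⇨ y) * x ≤ y :=
  (MTLAlgebra.mul_le_iff _ _ _).2 le_rfl

theorem MTLAlgebra.imp_eq_one {A : Type} [MTLAlgebra A] {x y : A} (h : x ≤ y) : x ⇨ y = 1 :=
  le_antisymm (MTLAlgebra.le_one _) ((MTLAlgebra.mul_le_iff _ _ _).1 (by rwa [one_mul]))

theorem MTLAlgebra.mul_le_left {A : Type} [MTLAlgebra A] (x y : A) : x * y ≤ x := by
  have h : y ≤ x ⇨ x := by rw [MTLAlgebra.imp_eq_one le_rfl]; exact MTLAlgebra.le_one y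
  rw [mul_comm]
  exact (MTLAlgebra.mul_le_iff _ _ _).2 h

theorem IsDPChain.eq_one_or_lt {C : Type} [MTLAlgebra C] (x : C) : x = 1 ∨ x < 1 :=
  (MTLAlgebra.le_one x).eq_or_lt

variable {A : Type} [MTLAlgebra A]

theorem IsDPAlgebra.inf_sq_le (hA : IsDPAlgebra A) (x y : A) :
    x ⊓ ((x ⇨ y) * (x ⇨ y)) ≤ y := by
  let X : DPTerm (Fin 2) := .var 0
  let Y : DPTerm (Fin 2) := .var 1
  have h := hA 2 (.sup (.inf X (.mul (.imp X Y) (.imp X Y))) Y) Y ?_ ![x, y]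
  · simpa [X, Y, DPTerm.eval] using h
  · intro C _ hC v
    simp only [X, Y, DPTerm.eval, sup_eq_right]
    rcases IsDPChain.eq_one_or_lt (v 0 ⇨ v 1) with h | h
    · have := MTLAlgebra.imp_mul_le (v 0) (v 1)
      rw [h, one_mul] at this
      exact inf_le_left.trans this
    · rw [hC.mul_of_lt _ _ h h]
      exact inf_le_right.trans bot_le

theorem IsDPAlgebra.sq_sup (hA : IsDPAlgebra A) (u y : A) :
    (y * y) ⊔ (y ⇨ (u ⊔ (u ⇨ ⊥))) = 1 := by
  let U : DPTerm (Fin 2) := .var 0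
  let Y : DPTerm (Fin 2) := .var 1
  have h := hA 2 (.sup (.mul Y Y) (.imp Y (.sup U (.imp U .zero)))) .one ?_ ![u, y]
  · simpa [U, Y, DPTerm.eval] using h
  · intro C _ hC v
    simp only [U, Y, DPTerm.eval]
    apply le_antisymm (MTLAlgebra.le_one _)
    rcases IsDPChain.eq_one_or_lt (v 1) with h | h
    · rw [h, one_mul]; exact le_sup_left
    · refine le_trans (le_of_eq (MTLAlgebra.imp_eq_one ?_).symm) le_sup_right
      rcases IsDPChain.eq_one_or_lt (v 0) with h0 | h0
      · rw [h0]; exact (MTLAlgebra.le_one _).trans le_sup_left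
      · refine le_trans ?_ le_sup_right
        rw [← MTLAlgebra.mul_le_iff, hC.mul_of_lt _ _ h h0]

theorem PrimeFilter.inf_mem (m : PrimeFilter A) {x y : A} (hx : x ∈ m.carrier)
    (hy : y ∈ m.carrier) : x ⊓ y ∈ m.carrier :=
  m.up (m.mul_mem hx hy)
    (le_inf (MTLAlgebra.mul_le_left _ _) (by rw [mul_comm]; exact MTLAlgebra.mul_le_left _ _))

/-- `m` itself is a prime lattice filter. -/
def PrimeFilter.self (m : PrimeFilter A) : PrimeLatFilterOver m where
  carrier := m.carrier
  le _ h := h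
  up := m.up
  inf_mem := m.inf_mem
  bot_notMem := m.bot_notMem
  prime := m.prime

theorem PrimeLatFilterOver.mp (hA : IsDPAlgebra A) {m : PrimeFilter A}
    (P : PrimeLatFilterOver m) {x y : A} (hx : x ∈ P.carrier) (h : (x ⇨ y) ∈ m.carrier) :
    y ∈ P.carrier :=
  P.up (P.inf_mem hx (P.le (m.mul_mem h h))) (hA.inf_sq_le x y)

theorem PrimeFilter.imp_or (m : PrimeFilter A) (x y : A) :
    (x ⇨ y) ∈ m.carrier ∨ (y ⇨ x) ∈ m.carrier :=
  m.prime (by rw [MTLAlgebra.prelinear]; exact m.one_mem)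

theorem PrimeLatFilterOver.total (hA : IsDPAlgebra A) {m : PrimeFilter A}
    (P Q : PrimeLatFilterOver m) : P.carrier ⊆ Q.carrier ∨ Q.carrier ⊆ P.carrier := by
  by_contra h
  simp only [not_or, Set.not_subset] at h
  obtain ⟨⟨x, hxP, hxQ⟩, y, hyQ, hyP⟩ := h
  rcases m.imp_or x y with h | h
  · exact hyP (P.mp hA hxP h)
  · exact hxQ (Q.mp hA hyQ h)

/-- The prime lattice filters over `m`, ordered by reverse inclusion, form a chain. (In a chain,
`↑a ⊇ ↑b` iff `a ≤ b`, and the maximum is the filter `m = ↑1` modulo `m`.) -/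
@[reducible]
noncomputable def PrimeLatFilterOver.linearOrder (hA : IsDPAlgebra A) (m : PrimeFilter A) :
    LinearOrder (PrimeLatFilterOver m) where
  le P Q := Q.carrier ⊆ P.carrier
  lt P Q := Q.carrier ⊆ P.carrier ∧ ¬ P.carrier ⊆ Q.carrier
  le_refl _ := subset_rfl
  le_trans _ _ _ h h' := h'.trans h
  le_antisymm _ _ h h' := PrimeLatFilterOver.ext (h'.antisymm h)
  lt_iff_le_not_ge _ _ := Iff.rfl
  le_total P Q := PrimeLatFilterOver.total hA Q P
  toDecidableLE := Classical.decRel _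

theorem PrimeFilter.finite [Finite A] : Finite (PrimeFilter A) :=
  Finite.of_injective PrimeFilter.carrier fun _ _ h => PrimeFilter.ext h

theorem PrimeLatFilterOver.finite [Finite A] (m : PrimeFilter A) :
    Finite (PrimeLatFilterOver m) :=
  Finite.of_injective PrimeLatFilterOver.carrier fun _ _ h => PrimeLatFilterOver.ext h

variable {B : Type} [MTLAlgebra B]

theorem MTLHom.comapLat_surjective (hA : IsDPAlgebra A) (f : MTLHom A B)
    (m : PrimeFilter B) : Function.Surjective (f.comapLat m) := by
  intro Q
  have tr : ∀ a b c : B, (a ⇨ b) * (b ⇨ c) ≤ a ⇨ c := fun a b c => by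
    rw [← MTLAlgebra.mul_le_iff]
    calc (a ⇨ b) * (b ⇨ c) * a = (b ⇨ c) * ((a ⇨ b) * a) := by
          rw [mul_comm (a ⇨ b), mul_assoc]
      _ ≤ c := by
          rw [mul_comm, MTLAlgebra.mul_le_iff]
          refine (MTLAlgebra.imp_mul_le a b).trans ?_
          rw [← MTLAlgebra.mul_le_iff, mul_comm]
          exact MTLAlgebra.imp_mul_le b c
  have key : ∀ {q x : A}, q ∈ Q.carrier → (f.toFun q ⇨ f.toFun x) ∈ m.carrier →
      x ∈ Q.carrier := fun {q x} hq h =>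
    Q.mp hA hq (by change f.toFun (q ⇨ x) ∈ m.carrier; rwa [f.map_imp])
  have le_mem : ∀ {a b : B}, a ≤ b → (a ⇨ b) ∈ m.carrier := fun {a b} h => by
    rw [MTLAlgebra.imp_eq_one h]; exact m.one_mem
  have one_q : (1 : A) ∈ Q.carrier := Q.le (f.comapPrime m).one_mem
  refine ⟨⟨{y | ∃ q ∈ Q.carrier, (f.toFun q ⇨ y) ∈ m.carrier}, ?_, ?_, ?_, ?_, ?_⟩, ?_⟩
  · intro y hy
    refine ⟨1, one_q, ?_⟩
    refine m.up hy ?_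
    rw [← MTLAlgebra.mul_le_iff, f.map_one, mul_one]
  · rintro x y ⟨q, hq, h⟩ hxy
    exact ⟨q, hq, m.up (m.mul_mem h (le_mem hxy)) (tr _ _ _)⟩
  · rintro x y ⟨q, hq, h⟩ ⟨r, hr, h'⟩
    refine ⟨q ⊓ r, Q.inf_mem hq hr, ?_⟩
    have h1 := m.up (m.mul_mem (le_mem (f.mono (inf_le_left : q ⊓ r ≤ q))) h) (tr _ _ _)
    have h2 := m.up (m.mul_mem (le_mem (f.mono (inf_le_right : q ⊓ r ≤ r))) h') (tr _ _ _)
    refine m.up (m.inf_mem h1 h2) ?_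
    rw [← MTLAlgebra.mul_le_iff]
    exact le_inf
      ((MTLAlgebra.mul_le_iff _ _ _).2 inf_le_left) ((MTLAlgebra.mul_le_iff _ _ _).2 inf_le_right)
  · rintro ⟨q, hq, h⟩
    exact Q.bot_notMem (key hq (by rwa [f.map_bot]))
  · rintro x y ⟨q, hq, h⟩
    rcases m.imp_or x y with hx | hy
    · refine Or.inr ⟨q, hq, m.up (m.mul_mem h ?_) (tr _ (x ⊔ y) _)⟩
      refine m.up hx ?_
      rw [← MTLAlgebra.mul_le_iff, mul_comm, MTLAlgebra.mul_le_iff]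
      refine sup_le ?_ ?_
      · rw [← MTLAlgebra.mul_le_iff, mul_comm]; exact MTLAlgebra.imp_mul_le _ _
      · rw [← MTLAlgebra.mul_le_iff]; exact MTLAlgebra.mul_le_left _ _
    · refine Or.inl ⟨q, hq, m.up (m.mul_mem h ?_) (tr _ (x ⊔ y) _)⟩
      refine m.up hy ?_
      rw [← MTLAlgebra.mul_le_iff, mul_comm, MTLAlgebra.mul_le_iff]
      refine sup_le ?_ ?_
      · rw [← MTLAlgebra.mul_le_iff]; exact MTLAlgebra.mul_le_left _ _
      · rw [← MTLAlgebra.mul_le_iff, mul_comm]; exact MTLAlgebra.imp_mul_le _ _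
  · apply PrimeLatFilterOver.ext
    ext x
    exact ⟨fun ⟨q, hq, h⟩ => key hq h, fun hx => ⟨x, hx, le_mem le_rfl⟩⟩

theorem MTLHom.comapLat_eq_self (hA : IsDPAlgebra A) (hB : IsDPAlgebra B) (f : MTLHom A B)
    (m : PrimeFilter B) (hne : ¬ Subsingleton (PrimeLatFilterOver (f.comapPrime m)))
    (P : PrimeLatFilterOver m) (hP : f.comapLat m P = (f.comapPrime m).self) :
    P = m.self := by
  have hc : ∀ x, f.toFun x ∈ P.carrier ↔ f.toFun x ∈ m.carrier := fun x =>
    Set.ext_iff.1 (congrArg PrimeLatFilterOver.carrier hP) x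
  obtain ⟨Q, u, huQ, hum⟩ : ∃ Q : PrimeLatFilterOver (f.comapPrime m),
      ∃ u ∈ Q.carrier, u ∉ (f.comapPrime m).carrier := by
    by_contra h
    push Not at h
    exact hne ⟨fun Q R => PrimeLatFilterOver.ext
      ((Set.Subset.antisymm (h Q) Q.le).trans (Set.Subset.antisymm (h R) R.le).symm)⟩
  apply PrimeLatFilterOver.ext
  refine Set.Subset.antisymm (fun y hy => ?_) P.le
  by_contra hym
  have hym : y ∉ m.carrier := hym
  have h1 : (y ⇨ (f.toFun u ⊔ (f.toFun u ⇨ ⊥))) ∈ m.carrier := by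
    have h0 : y * y ⊔ (y ⇨ (f.toFun u ⊔ (f.toFun u ⇨ ⊥))) ∈ m.carrier := by
      rw [hB.sq_sup]; exact m.one_mem
    rcases m.prime h0 with h | h
    · exact absurd (m.up h (MTLAlgebra.mul_le_left y y)) hym
    · exact h
  have h2 := P.mp hB hy h1
  rw [← f.map_bot, ← f.map_imp, ← f.map_sup, hc, f.map_sup] at h2
  rcases m.prime h2 with h | h
  · exact hum h
  · exact Q.bot_notMem (Q.mp hA huQ h)

end facts

/-- The multiset of chains dual to a finite DP-algebra `A`: for every prime filter `m` of `A` the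
chain of prime lattice filters of the quotient chain `A / m`. -/
noncomputable def dualObj (A : FinDPAlg) : MCTop where
  ι := PrimeFilter A.carrier
  finIdx := PrimeFilter.finite
  chain m := PrimeLatFilterOver m
  lin m := PrimeLatFilterOver.linearOrder A.isDP m
  fin m := PrimeLatFilterOver.finite m
  ne m := ⟨m.self⟩

theorem dualObj_isTop (A : FinDPAlg) (m : (dualObj A).ι) (P : (dualObj A).chain m) :
    IsTop P ↔ P = PrimeFilter.self m :=
  ⟨fun h => PrimeLatFilterOver.ext
      (Set.Subset.antisymm (h (PrimeFilter.self m)) (PrimeLatFilterOver.le P)),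
    fun h Q => by
      subst h
      exact PrimeLatFilterOver.le Q⟩

/-- The functor `MC` implementing the duality between finite DP-algebras and multisets of chains.
A homomorphism is sent to the family of its preimage maps on prime (lattice) filters. -/
noncomputable def MC : FinDPAlgᵒᵖ ⥤ MCTop where
  obj A := dualObj A.unop
  map {A B} f :=
    { idx := fun m => MTLHom.comapPrime f.unop m
      map := fun m P => MTLHom.comapLat f.unop m P
      mono := fun m P Q h => Set.preimage_mono (f := MTLHom.toFun f.unop)
        (show PrimeLatFilterOver.carrier Q ⊆ PrimeLatFilterOver.carrier P from h)
      surj := fun m => MTLHom.comapLat_surjective B.unop.isDP f.unop m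
      top := fun m hne => by
        ext P
        refine (dualObj_isTop _ _ _).trans (Iff.trans ?_ (dualObj_isTop _ _ _).symm)
        constructor
        · exact MTLHom.comapLat_eq_self B.unop.isDP A.unop.isDP f.unop m hne P
        · intro h; rw [h]; rfl }

/-! ### The free algebras and the multiplicities -/

/-- The free DP-algebra `F_k` over `k` generators, once known to be finite. -/
def freeAlg (k : ℕ) (hfin : Finite (FreeDP (Fin k))) : FinDPAlg where
  carrier := FreeDP (Fin k)
  fin := hfin
  isDP := FreeDP.isDP

/-- The number `∑_{i=0}^{h-2} (-1)^i C(h-2, i) (h+1-i)^k` (for `h ≥ 2`). -/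
def chainCoeff (k h : ℕ) : ℤ :=
  ∑ i ∈ Finset.range (h - 2 + 1), (-1) ^ i * ((h - 2).choose i : ℤ) * ((h : ℤ) + 1 - i) ^ k

/-! The free algebra is a finite product of chains, and everything is read off from its factors. An
identity is tested by assignments in drastic product chains. The values of an assignment, together
with the bounds and the coatom (present exactly when some value is intermediate), form a finite
subalgebra, so each assignment into a nontrivial chain factors through a generating assignment in
some `StdChain n` with `n ≤ k + 1` (`exists_generates`). Hence evaluations at generating assignments
separate points (`ext_ev`).

Conversely, `x * x` takes only the values `⊥` and `⊤` on such a chain, so distinct generating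
assignments are separated by elements with values `⊤` and `⊥`. Joins and meets of these realize
every tuple of values (`exists_ev_eq`), which gives `bijective_ev`.

Prime filters of the product correspond to its factors, and the factor with `n + 2` elements has a
dual chain of `n + 1` elements. Objects of `MCTop` are determined up to isomorphism by how many
chains of each size they have (`iso_of_profile`). It remains to count generating assignments, which
for `n ≥ 2` is inclusion-exclusion for functions covering the `n - 1` elements strictly between `⊥`
and the coatom (`numGenerates_eq`). -/

/-! ### Finite drastic product chains -/

/-- The drastic product chain with `n + 2` elements. -/
def StdChain (n : ℕ) : Type := Fin (n + 2)

namespace StdChain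

variable {n : ℕ}

instance : LinearOrder (StdChain n) := inferInstanceAs (LinearOrder (Fin (n + 2)))
instance : BoundedOrder (StdChain n) := inferInstanceAs (BoundedOrder (Fin (n + 2)))
instance : Fintype (StdChain n) := inferInstanceAs (Fintype (Fin (n + 2)))

/-- The largest element below `⊤`. -/
def coatom (n : ℕ) : StdChain n := (⟨n, by omega⟩ : Fin (n + 2))

/-- The number of elements below `x`. -/
def rank (x : StdChain n) : ℕ := Fin.val (n := n + 2) x

theorem lt_iff {x y : StdChain n} : x < y ↔ x.rank < y.rank := Iff.rfl
theorem le_iff {x y : StdChain n} : x ≤ y ↔ x.rank ≤ y.rank := Iff.rfl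
theorem rank_coatom : (coatom n).rank = n := rfl
theorem rank_top : (⊤ : StdChain n).rank = n + 1 := rfl
theorem rank_bot : (⊥ : StdChain n).rank = 0 := rfl

theorem coatom_lt : coatom n < ⊤ := by
  rw [lt_iff, rank_coatom, rank_top]; omega

theorem le_coatom {x : StdChain n} (h : x < ⊤) : x ≤ coatom n := by
  rw [lt_iff, rank_top] at h
  rw [le_iff, rank_coatom]; omega

theorem bot_lt_top : (⊥ : StdChain n) < ⊤ := by
  rw [lt_iff, rank_bot, rank_top]; omega

theorem bot_lt_coatom (h : 0 < n) : ⊥ < coatom n := by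
  rwa [lt_iff, rank_bot, rank_coatom]

theorem pos_of_lt {x y : StdChain n} (h : x < y) (hy : y < ⊤) : 0 < n := by
  rw [lt_iff] at h hy
  rw [rank_top] at hy
  omega

instance : MTLAlgebra (StdChain n) where
  mul x y := if x = ⊤ then y else if y = ⊤ then x else ⊥
  one := ⊤
  himp x y := if x ≤ y then ⊤ else if x = ⊤ then y else coatom n
  mul_assoc a b c := by
    change ite _ _ _ = ite _ _ _
    simp only [HMul.hMul]
    have := (bot_lt_top (n := n)).ne
    split_ifs <;> simp_all
  mul_comm a b := by
    simp only [HMul.hMul]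
    split_ifs <;> simp_all
  one_mul a := if_pos rfl
  mul_one a := by
    change (if a = ⊤ then ⊤ else if ⊤ = ⊤ then a else ⊥) = a
    split_ifs <;> simp_all
  one_eq_top := rfl
  mul_le_iff a b c := by
    change (if a = ⊤ then b else if b = ⊤ then a else ⊥) ≤ c ↔
      a ≤ if b ≤ c then ⊤ else if b = ⊤ then c else coatom n
    have h1 := fun h : a ≠ ⊤ => le_coatom (lt_top_iff_ne_top.2 h)
    have h2 := coatom_lt (n := n)
    split_ifs with ha hb hc hb' hc hb <;> simp_all
    exact iff_of_false hb.not_ge h2.ne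
  prelinear a b := by
    change (if a ≤ b then ⊤ else _) ⊔ (if b ≤ a then ⊤ else _) = (⊤ : StdChain n)
    rcases le_total a b with h | h <;> simp [h]

theorem one_def : (1 : StdChain n) = ⊤ := rfl
theorem mul_def (x y : StdChain n) :
    x * y = if x = ⊤ then y else if y = ⊤ then x else ⊥ := rfl
theorem himp_def (x y : StdChain n) :
    x ⇨ y = if x ≤ y then ⊤ else if x = ⊤ then y else coatom n := rfl

theorem isDPChain (n : ℕ) : IsDPChain (StdChain n) where
  total := le_total
  mul_of_lt x y hx hy := by
    exact (if_neg hx.ne).trans (if_neg hy.ne)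
  mul_of_not_lt x y h := by
    rw [one_def, not_and_or, not_lt_top_iff, not_lt_top_iff] at h
    rw [mul_def]
    rcases h with rfl | rfl
    · simp
    · simpa using fun h => h.symm

theorem himp_eq_top {x y : StdChain n} : x ⇨ y = ⊤ ↔ x ≤ y := by
  refine ⟨fun h => ?_, fun h => if_pos h⟩
  by_contra hxy
  rw [himp_def, if_neg hxy] at h
  split_ifs at h with hx
  · exact hxy (h ▸ le_top)
  · exact coatom_lt.ne h

/-- This makes the coatom definable from any intermediate value, so it need not be a value of the
generators. -/
theorem himp_bot {x : StdChain n} (h0 : ⊥ < x) (h1 : x < ⊤) : x ⇨ ⊥ = coatom n := by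
  rw [himp_def, if_neg (by simpa using h0.ne'), if_neg h1.ne]

theorem mul_self_eq {x : StdChain n} : x * x = if x = ⊤ then ⊤ else ⊥ := by
  rw [mul_def]; split_ifs <;> simp_all

/-- A strictly increasing map from a standard chain to a drastic product chain that preserves
the bounds and the coatom is a homomorphism. -/
def hom {C : Type} [MTLAlgebra C] (hC : IsDPChain C) (e : StdChain n → C) (he : StrictMono e)
    (h0 : e ⊥ = ⊥) (h1 : e ⊤ = 1) (hc : 0 < n → ∀ x < (1 : C), x ≤ e (coatom n)) :
    MTLHom (StdChain n) C where
  toFun := e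
  map_mul x y := by
    rw [mul_def]
    split_ifs with hx hy
    · rw [hx, h1, one_mul]
    · rw [hy, h1, mul_one]
    · rw [h0, hC.mul_of_lt] <;> rw [← h1] <;> exact he (lt_top_iff_ne_top.2 ‹_›)
  map_imp x y := by
    rw [himp_def]
    split_ifs with hxy hx
    · rw [h1, MTLAlgebra.imp_eq_one (he.monotone hxy)]
    · rw [hx, h1]
      refine le_antisymm ((MTLAlgebra.mul_le_iff _ _ _).1 (by rw [mul_one])) ?_
      have := MTLAlgebra.imp_mul_le 1 (e y)
      rwa [mul_one] at this
    · have hx := lt_top_iff_ne_top.2 hx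
      have hxy := not_le.1 hxy
      have e1 : ∀ {z}, z < ⊤ → e z < 1 := fun hz => by rw [← h1]; exact he hz
      -- Products of elements below `1` vanish, which gives one inequality. For the other, `hc`
      -- applies because `y < x < ⊤` forces `0 < n`, and the residuum is not `1` since `e y < e x`.
      refine le_antisymm ((MTLAlgebra.mul_le_iff _ _ _).1 ?_) (hc (pos_of_lt hxy hx) _ ?_)
      · rw [hC.mul_of_lt _ _ (e1 coatom_lt) (e1 hx)]; exact bot_le
      · refine (MTLAlgebra.le_one _).lt_of_ne fun h => (he hxy).not_ge ?_
        rw [← one_mul (e x), ← h]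
        exact MTLAlgebra.imp_mul_le _ _
  map_inf x y := by
    rcases le_total x y with h | h
    · rw [inf_eq_left.2 h, inf_eq_left.2 (he.monotone h)]
    · rw [inf_eq_right.2 h, inf_eq_right.2 (he.monotone h)]
  map_sup x y := by
    rcases le_total x y with h | h
    · rw [sup_eq_right.2 h, sup_eq_right.2 (he.monotone h)]
    · rw [sup_eq_left.2 h, sup_eq_left.2 (he.monotone h)]
  map_bot := h0
  map_one := h1

/-! ### Generating assignments -/

/-- The values of `w` generate the standard chain. -/
def Generates {k n : ℕ} (w : Fin k → StdChain n) : Prop :=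
  (∀ j, ⊥ < j → j < coatom n → ∃ a, w a = j) ∧ (0 < n → ∃ a, ⊥ < w a ∧ w a < ⊤)

/-- Every assignment in a nontrivial drastic product chain factors through a generating
assignment in a standard chain. -/
theorem exists_generates {k : ℕ} {C : Type} [MTLAlgebra C] (hC : IsDPChain C)
    (hne : (⊥ : C) ≠ 1) (v : Fin k → C) :
    ∃ n < k + 2, ∃ w : Fin k → StdChain n, Generates w ∧
      ∃ f : MTLHom (StdChain n) C, ∀ a, v a = f.toFun (w a) := by
  classical
  have : Std.Total (α := C) (· ≤ ·) := ⟨hC.total⟩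
  let : LinearOrder C := Lattice.toLinearOrder C
  have hb : (⊥ : C) < 1 := bot_le.lt_of_ne hne
  -- An intermediate value `v a` provides the coatom of `C` as its negation. Without one, `C` may
  -- have no coatom; then `c = ⊥` is a default that adds nothing to `S`.
  obtain ⟨c, hc1, hc⟩ : ∃ c : C, c < 1 ∧ ((∃ a, ⊥ < v a ∧ v a < 1) ∧ (∀ x < 1, x ≤ c) ∨
      (∀ a, v a = ⊥ ∨ v a = 1) ∧ c = ⊥) := by
    by_cases h : ∃ a, ⊥ < v a ∧ v a < 1
    · obtain ⟨a, ha0, ha1⟩ := h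
      refine ⟨v a ⇨ ⊥, (MTLAlgebra.le_one _).lt_of_ne fun h => ha0.not_ge ?_,
        Or.inl ⟨⟨a, ha0, ha1⟩, fun x hx => ?_⟩⟩
      · rw [← one_mul (v a), ← h]
        exact MTLAlgebra.imp_mul_le _ _
      · rw [← MTLAlgebra.mul_le_iff, hC.mul_of_lt _ _ hx ha1]
    · refine ⟨⊥, hb, Or.inr ⟨fun a => ?_, rfl⟩⟩
      by_contra! h'
      exact h ⟨a, bot_le.lt_of_ne h'.1.symm, (MTLAlgebra.le_one _).lt_of_ne h'.2⟩
  let S : Finset C := insert ⊥ (insert 1 (insert c (Finset.univ.image v)))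
  have hS2 : 2 ≤ S.card := by
    rw [← Finset.card_pair hne]
    refine Finset.card_le_card (Finset.insert_subset_insert _ ?_)
    simp
  -- At most `k` values and three extra elements; since `S.card = n + 2`, this is the bound `n < k +
  -- 2`.
  have hSk : S.card ≤ k + 3 := by
    have h1 := Finset.card_insert_le ⊥ (insert 1 (insert c (Finset.univ.image v)))
    have h2 := Finset.card_insert_le 1 (insert c (Finset.univ.image v))
    have h3 := Finset.card_insert_le c (Finset.univ.image v)
    have h4 := Finset.card_image_le (s := Finset.univ) (f := v)
    simp only [Finset.card_univ, Fintype.card_fin] at h4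
    simp only [S]; omega
  obtain ⟨n, hn⟩ := Nat.exists_eq_add_of_le' hS2
  let e : StdChain n → C := S.orderEmbOfFin hn
  have he : StrictMono e := (S.orderEmbOfFin hn).strictMono
  have heS : ∀ x, e x ∈ S := fun x => Finset.orderEmbOfFin_mem S hn x
  have hr : ∀ x ∈ S, ∃ y, e y = x := fun x hx => by
    have := Finset.range_orderEmbOfFin S hn
    exact (Set.ext_iff.1 this x).2 hx
  have hmem : ∀ x, x ∈ S ↔ x = ⊥ ∨ x = 1 ∨ x = c ∨ ∃ a, v a = x := fun x => by simp [S]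
  have h0 : e ⊥ = ⊥ := by
    obtain ⟨y, hy⟩ := hr ⊥ ((hmem _).2 (by simp))
    exact le_bot_iff.1 (hy ▸ he.monotone bot_le)
  have h1 : e ⊤ = 1 := by
    obtain ⟨y, hy⟩ := hr 1 ((hmem _).2 (by simp))
    exact le_antisymm (MTLAlgebra.le_one _) (hy ▸ he.monotone le_top)
  -- In the default case `S` is only `{⊥, 1}`, whereas `0 < n` places `e (coatom n)` strictly
  -- between.
  have hpos : 0 < n → (∃ a, ⊥ < v a ∧ v a < 1) ∧ ∀ x < 1, x ≤ c := fun hn0 => by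
    rcases hc with h | ⟨hv, hc0⟩
    · exact h
    · have hl := h0 ▸ he (bot_lt_coatom hn0)
      have hu := h1 ▸ he (coatom_lt (n := n))
      rcases (hmem _).1 (heS (coatom n)) with h | h | h | ⟨a, h⟩
      · exact absurd h hl.ne'
      · exact absurd h hu.ne
      · exact absurd (h.trans hc0) hl.ne'
      · rcases hv a with h' | h'
        · exact absurd (h ▸ h') hl.ne'
        · exact absurd (h ▸ h') hu.ne
  have hco : 0 < n → e (coatom n) = c := fun hn0 => by
    refine le_antisymm ((hpos hn0).2 _ (h1 ▸ he coatom_lt)) ?_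
    obtain ⟨y, hy⟩ := hr c ((hmem _).2 (by simp))
    rw [← hy, ← h1, he.lt_iff_lt] at hc1
    rw [← hy]
    exact he.monotone (le_coatom hc1)
  have hw : ∀ a, ∃ y, e y = v a := fun a => hr _ ((hmem _).2 (by simp))
  choose w hw using hw
  refine ⟨n, by omega, w, ⟨fun j hj0 hj1 => ?_, fun hn0 => ?_⟩,
    hom hC e he h0 h1 (fun hn0 x hx => hco hn0 ▸ (hpos hn0).2 x hx), fun a => (hw a).symm⟩
  · have hn0 : 0 < n := pos_of_lt hj1 coatom_lt
    rcases (hmem _).1 (heS j) with h | h | h | ⟨a, h⟩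
    · exact absurd (h ▸ h0 ▸ he hj0) (lt_irrefl _)
    · exact absurd (he.injective (h.trans h1.symm)) (hj1.trans coatom_lt).ne
    · exact absurd (he.injective (h.trans (hco hn0).symm)) hj1.ne
    · exact ⟨a, he.injective ((hw a).trans h)⟩
  · obtain ⟨a, ha0, ha1⟩ := (hpos hn0).1
    rw [← hw a, ← h0, he.lt_iff_lt] at ha0
    rw [← hw a, ← h1, he.lt_iff_lt] at ha1
    exact ⟨a, ha0, ha1⟩

end StdChain

/-! ### The free algebra as a product of chains -/

/-- The homomorphism from the free algebra to a drastic product chain given by an assignment. -/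
def FreeDP.lift {α C : Type} [MTLAlgebra C] (hC : IsDPChain C) (v : α → C) :
    MTLHom (FreeDP α) C where
  toFun := Quotient.lift (fun t => t.eval v) fun _ _ h => h C hC v
  map_mul x y := by induction x using FreeDP.ind; induction y using FreeDP.ind; rfl
  map_imp x y := by induction x using FreeDP.ind; induction y using FreeDP.ind; rfl
  map_inf x y := by induction x using FreeDP.ind; induction y using FreeDP.ind; rfl
  map_sup x y := by induction x using FreeDP.ind; induction y using FreeDP.ind; rfl
  map_bot := rfl
  map_one := rfl

/-- The generating assignments of `k` variables in standard chains. -/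
abbrev GenIndex (k : ℕ) : Type :=
  Σ i : Fin (k + 2), {w : Fin k → StdChain i // StdChain.Generates w}

/-- Sending `f x` to `g x` is a well-defined order isomorphism, and finite chains are rigid. -/
theorem StdChain.eq_of_le_iff {X : Type} {n m : ℕ} {f : X → StdChain n} {g : X → StdChain m}
    (hf : Function.Surjective f) (hg : Function.Surjective g)
    (h : ∀ x y, f x ≤ f y ↔ g x ≤ g y) : n = m ∧ ∀ x, HEq (f x) (g x) := by
  let e : StdChain n ≃o StdChain m := StrictMono.orderIsoOfSurjective
    (fun a => g (Function.surjInv hf a))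
    (fun a b hab => lt_iff_le_not_ge.2 (by
      rw [← h, ← h, Function.surjInv_eq hf a, Function.surjInv_eq hf b]
      exact lt_iff_le_not_ge.1 hab))
    (fun b => by
      obtain ⟨x, rfl⟩ := hg b
      have hx := Function.surjInv_eq hf (f x)
      exact ⟨f x, le_antisymm ((h _ _).1 hx.le) ((h _ _).1 hx.ge)⟩)
  have he : ∀ x, e (f x) = g x := fun x => by
    have hx := Function.surjInv_eq hf (f x)
    exact le_antisymm ((h _ _).1 hx.le) ((h _ _).1 hx.ge)
  have hc : Fintype.card (Fin (n + 2)) = Fintype.card (Fin (m + 2)) :=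
    Fintype.card_congr e.toEquiv
  simp only [Fintype.card_fin, Nat.add_right_cancel_iff] at hc
  subst hc
  refine ⟨rfl, fun x => heq_of_eq ?_⟩
  rw [← he, Subsingleton.elim e (OrderIso.refl _)]
  rfl

namespace GenIndex

variable {k : ℕ}

noncomputable instance (n : ℕ) : Fintype {w : Fin k → StdChain n // StdChain.Generates w} := by
  classical infer_instance

/-- Evaluation of an element of the free algebra at a generating assignment. -/
def ev (p : GenIndex k) : MTLHom (FreeDP (Fin k)) (StdChain p.1) :=
  FreeDP.lift (StdChain.isDPChain p.1) p.2.1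

theorem ev_top (p : GenIndex k) : p.ev.toFun ⊤ = ⊤ := p.ev.map_one

theorem ext_ev {x y : FreeDP (Fin k)} (h : ∀ p : GenIndex k, p.ev.toFun x = p.ev.toFun y) :
    x = y := by
  induction x using FreeDP.ind with | h s
  induction y using FreeDP.ind with | h t
  refine FreeDP.mk_eq.2 fun C _ hC v => ?_
  by_cases hne : (⊥ : C) = 1
  · have : ∀ a : C, a = ⊥ := fun a => le_bot_iff.1 (hne ▸ MTLAlgebra.le_one a)
    rw [this (s.eval v), this (t.eval v)]
  · obtain ⟨n, hn, w, hw, f, hf⟩ := StdChain.exists_generates hC hne v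
    rw [funext hf, ← f.map_eval, ← f.map_eval]
    exact congrArg f.toFun (h ⟨⟨n, hn⟩, w, hw⟩)

theorem ev_surjective (p : GenIndex k) : Function.Surjective p.ev.toFun := by
  obtain ⟨⟨n, hn⟩, w, hw⟩ := p
  intro (j : StdChain n)
  rcases eq_bot_or_bot_lt j with h0 | h0
  · exact ⟨⊥, h0.symm⟩
  rcases eq_top_or_lt_top j with h1 | h1
  · exact ⟨1, h1.symm⟩
  rcases (StdChain.le_coatom h1).eq_or_lt with hc | hc
  · obtain ⟨a, ha0, ha1⟩ := hw.2 (StdChain.pos_of_lt h0 h1)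
    exact ⟨FreeDP.of a ⇨ ⊥, (StdChain.himp_bot ha0 ha1).trans hc.symm⟩
  · obtain ⟨a, ha⟩ := hw.1 j h0 hc
    exact ⟨FreeDP.of a, ha⟩

/-- Otherwise the same elements take the value `⊤` at `p` and at `q`. Since `x ⇨ y = ⊤` encodes `x ≤
y`, both evaluations induce the same preorder, and rigidity of finite chains gives `p = q`. -/
theorem exists_ev_top_bot {p q : GenIndex k} (hpq : p ≠ q) :
    ∃ x, p.ev.toFun x = ⊤ ∧ q.ev.toFun x = ⊥ := by
  by_contra! hcon
  have key : ∀ x, p.ev.toFun x = ⊤ → q.ev.toFun x = ⊤ := fun x hx => by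
    by_contra hq
    refine hcon (x * x) ?_ ?_
    · rw [MTLHom.map_mul, StdChain.mul_self_eq, if_pos hx]
    · rw [MTLHom.map_mul, StdChain.mul_self_eq, if_neg hq]
  have key' : ∀ x, q.ev.toFun x = ⊤ → p.ev.toFun x = ⊤ := fun x hx => by
    by_contra hp
    -- The negated square is `⊤` exactly where `x` is not `⊤`, so the converse inclusion follows
    -- from `key`.
    have h := key (x * x ⇨ ⊥) (by
      rw [MTLHom.map_imp, MTLHom.map_mul, StdChain.mul_self_eq, if_neg hp, MTLHom.map_bot,
        StdChain.himp_eq_top])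
    rw [MTLHom.map_imp, MTLHom.map_mul, StdChain.mul_self_eq, if_pos hx, MTLHom.map_bot,
      StdChain.himp_eq_top] at h
    exact h.not_gt StdChain.bot_lt_top
  have hle : ∀ x y, p.ev.toFun x ≤ p.ev.toFun y ↔ q.ev.toFun x ≤ q.ev.toFun y := fun x y => by
    rw [← StdChain.himp_eq_top, ← StdChain.himp_eq_top, ← MTLHom.map_imp, ← MTLHom.map_imp]
    exact ⟨key _, key' _⟩
  obtain ⟨h1, h2⟩ := StdChain.eq_of_le_iff p.ev_surjective q.ev_surjective hle
  obtain ⟨i, w, hw⟩ := p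
  obtain ⟨j, w', hw'⟩ := q
  obtain rfl : i = j := Fin.ext h1
  obtain rfl : w = w' := funext fun a => eq_of_heq (h2 (FreeDP.of a))
  exact hpq rfl

/-- Evaluation as a homomorphism of bounded lattices. -/
def evLat (p : GenIndex k) : BoundedLatticeHom (FreeDP (Fin k)) (StdChain p.1) where
  toFun := p.ev.toFun
  map_sup' := p.ev.map_sup
  map_inf' := p.ev.map_inf
  map_top' := p.ev_top
  map_bot' := p.ev.map_bot

/-- Take the meet, over the finitely many `q`, of elements separating `p` from `q`. -/
theorem exists_indicator (p : GenIndex k) :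
    ∃ x, p.ev.toFun x = ⊤ ∧ ∀ q, q ≠ p → q.ev.toFun x = ⊥ := by
  classical
  have h : ∀ q : GenIndex k, ∃ x, p.ev.toFun x = ⊤ ∧ (q ≠ p → q.ev.toFun x = ⊥) := fun q => by
    by_cases hq : q = p
    · exact ⟨⊤, p.ev_top, fun h => absurd hq h⟩
    · obtain ⟨x, hx, hx'⟩ := exists_ev_top_bot (Ne.symm hq)
      exact ⟨x, hx, fun _ => hx'⟩
  choose s hs hs' using h
  refine ⟨Finset.univ.inf s, ?_, fun q hq => ?_⟩
  · refine (map_finset_inf p.evLat _ _).trans ((Finset.inf_congr rfl fun q _ => hs q).trans ?_)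
    exact Finset.inf_top _
  · refine le_bot_iff.1 ?_
    rw [← hs' q hq]
    exact q.ev.mono (Finset.inf_le (Finset.mem_univ q))

/-- As in the Chinese remainder theorem: cut a preimage of each coordinate down by the indicator of
that coordinate, then join. -/
theorem exists_ev_eq (f : ∀ p : GenIndex k, StdChain p.1) :
    ∃ x, ∀ p : GenIndex k, p.ev.toFun x = f p := by
  classical
  choose e he he' using fun p : GenIndex k => p.exists_indicator
  choose t ht using fun p : GenIndex k => p.ev_surjective (f p)
  refine ⟨Finset.univ.sup fun p => t p ⊓ e p, fun p => le_antisymm ?_ ?_⟩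
  · refine (map_finset_sup p.evLat _ _).trans_le (Finset.sup_le fun q _ => ?_)
    refine (p.ev.map_inf _ _).trans_le ?_
    by_cases hq : p = q
    · subst hq; exact inf_le_left.trans (ht p).le
    · rw [he' q p hq, inf_bot_eq]; exact bot_le
  · refine le_trans ?_ (p.ev.mono (Finset.le_sup (Finset.mem_univ p)))
    exact (le_inf (ht p).ge ((he p).symm ▸ le_top)).trans (p.ev.map_inf _ _).ge

/-- The free algebra is the product of its chain quotients. -/
theorem bijective_ev :
    Function.Bijective fun (x : FreeDP (Fin k)) (p : GenIndex k) => p.ev.toFun x :=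
  ⟨fun _ _ h => ext_ev (congrFun h), fun f => (exists_ev_eq f).imp fun _ h => funext h⟩

theorem finite_freeDP (k : ℕ) : Finite (FreeDP (Fin k)) :=
  Finite.of_injective _ (bijective_ev (k := k)).injective

/-! ### Prime filters and prime lattice filters of the free algebra -/

/-- The prime filter of the elements that take the value `⊤` at `p`. -/
def primeFilter (p : GenIndex k) : PrimeFilter (FreeDP (Fin k)) where
  carrier := {x | p.ev.toFun x = ⊤}
  one_mem := p.ev.map_one
  up {x y} hx h := top_le_iff.1 ((show p.ev.toFun x = ⊤ from hx) ▸ p.ev.mono h)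
  mul_mem {x y} hx hy := by
    have hx : p.ev.toFun x = 1 := hx
    have hy : p.ev.toFun y = 1 := hy
    change p.ev.toFun (x * y) = 1
    rw [p.ev.map_mul, hx, hy, one_mul]
  bot_notMem h := StdChain.bot_lt_top.ne (p.ev.map_bot.symm.trans h)
  prime {x y} h := by
    have h : p.ev.toFun x ⊔ p.ev.toFun y = ⊤ := (p.ev.map_sup x y).symm.trans h
    rcases max_choice (p.ev.toFun x) (p.ev.toFun y) with h' | h'
    · exact Or.inl (h'.symm.trans h)
    · exact Or.inr (h'.symm.trans h)

theorem mem_primeFilter {p : GenIndex k} {x : FreeDP (Fin k)} :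
    x ∈ p.primeFilter.carrier ↔ p.ev.toFun x = ⊤ := Iff.rfl

theorem _root_.PrimeFilter.exists_mem_of_sup {A ι : Type} [MTLAlgebra A] (m : PrimeFilter A)
    (s : Finset ι) (e : ι → A) (h : s.sup e ∈ m.carrier) : ∃ i ∈ s, e i ∈ m.carrier := by
  classical
  induction s using Finset.induction_on with
  | empty => exact absurd h m.bot_notMem
  | insert a s _ ih =>
    rw [Finset.sup_insert] at h
    rcases m.prime h with h | h
    · exact ⟨a, Finset.mem_insert_self _ _, h⟩
    · obtain ⟨i, hi, h⟩ := ih h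
      exact ⟨i, Finset.mem_insert_of_mem hi, h⟩

/-- The indicators have join `1`, so a prime filter contains one of them, and this one determines
the filter. -/
theorem bijective_primeFilter :
    Function.Bijective (primeFilter : GenIndex k → PrimeFilter (FreeDP (Fin k))) := by
  constructor
  · intro p q h
    by_contra hpq
    obtain ⟨x, hx, hx'⟩ := exists_ev_top_bot hpq
    rw [← mem_primeFilter, h, mem_primeFilter, hx'] at hx
    exact StdChain.bot_lt_top.ne hx
  · intro m
    choose e he he' using fun p : GenIndex k => p.exists_indicator
    have hsup : Finset.univ.sup e = (1 : FreeDP (Fin k)) := ext_ev fun p =>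
      le_antisymm (p.ev.mono (MTLAlgebra.le_one _)) (by
        rw [p.ev.map_one, StdChain.one_def, ← he p]
        exact p.ev.mono (Finset.le_sup (Finset.mem_univ p)))
    obtain ⟨p, -, hp⟩ := m.exists_mem_of_sup Finset.univ e (hsup ▸ m.one_mem)
    refine ⟨p, PrimeFilter.ext (Set.ext fun x => ⟨fun hx => m.up (x := e p) hp ?_, fun hx => ?_⟩)⟩
    · rw [← inf_eq_left]
      refine ext_ev fun q => ?_
      rw [q.ev.map_inf]
      by_cases hq : q = p
      · subst hq; rw [mem_primeFilter.1 hx, inf_top_eq]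
      · rw [he' p q hq, bot_inf_eq]
    · rw [mem_primeFilter]
      by_contra hx'
      refine m.bot_notMem ?_
      -- The square kills the coordinate `p`, and the indicator kills all others.
      have hb : x * x * e p = ⊥ := ext_ev fun q => by
        rw [q.ev.map_mul, q.ev.map_bot]
        by_cases hq : q = p
        · subst hq; rw [q.ev.map_mul, StdChain.mul_self_eq, if_neg hx', he q]
          exact mul_one _
        · rw [he' p q hq]
          rw [mul_comm]
          exact le_bot_iff.1 (MTLAlgebra.mul_le_left _ _)
      exact hb ▸ m.mul_mem (m.mul_mem hx hx) hp

/-- The prime lattice filter over `p` cut out by a value. -/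
def cutFilter (p : GenIndex k) (j : {j : StdChain p.1 // j < ⊤}) :
    PrimeLatFilterOver p.primeFilter where
  carrier := {x | j.1 < p.ev.toFun x}
  le x hx := by
    change j.1 < p.ev.toFun x
    rw [mem_primeFilter.1 hx]; exact j.2
  up {x y} hx h := lt_of_lt_of_le hx (p.ev.mono h)
  inf_mem {x y} hx hy := by
    exact (lt_inf_iff.2 ⟨hx, hy⟩ : j.1 < p.ev.toFun x ⊓ p.ev.toFun y).trans_eq
      (p.ev.map_inf x y).symm
  bot_notMem h := not_lt_bot (p.ev.map_bot ▸ (show j.1 < p.ev.toFun ⊥ from h))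
  prime {x y} h := by
    have h : j.1 < p.ev.toFun x ⊔ p.ev.toFun y := lt_of_lt_of_eq h (p.ev.map_sup x y)
    exact lt_sup_iff.1 h

/-- By `PrimeLatFilterOver.mp`, membership depends only on the value at `p`. The filter is thus an
up-set of a finite chain, cut out by the largest value attained outside it. -/
theorem bijective_cutFilter (p : GenIndex k) : Function.Bijective p.cutFilter := by
  constructor
  · intro i j h
    have h' : ∀ x, i.1 < p.ev.toFun x ↔ j.1 < p.ev.toFun x := fun x =>
      Set.ext_iff.1 (congrArg PrimeLatFilterOver.carrier h) x
    obtain ⟨x, hx⟩ := p.ev_surjective i.1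
    obtain ⟨y, hy⟩ := p.ev_surjective j.1
    have hx' := h' x
    have hy' := h' y
    rw [hx] at hx'
    rw [hy] at hy'
    exact Subtype.ext (le_antisymm (not_lt.1 fun hl => lt_irrefl _ (hx'.2 hl))
      (not_lt.1 fun hl => lt_irrefl _ (hy'.1 hl)))
  · classical
    intro P
    have hP : ∀ x y, x ∈ P.carrier → p.ev.toFun x ≤ p.ev.toFun y → y ∈ P.carrier :=
      fun x y hx h => P.mp FreeDP.isDP hx (by
        rwa [mem_primeFilter, p.ev.map_imp, StdChain.himp_eq_top])
    let s : Finset (StdChain p.1) := Finset.univ.filter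
      fun j => ∃ x, p.ev.toFun x = j ∧ x ∉ P.carrier
    have hs : s.Nonempty := ⟨⊥, by simpa [s] using ⟨⊥, p.ev.map_bot, P.bot_notMem⟩⟩
    obtain ⟨x, hx, hxP⟩ := (Finset.mem_filter.1 (s.max'_mem hs)).2
    refine ⟨⟨p.ev.toFun x, lt_top_iff_ne_top.2 fun h => hxP (P.le h)⟩,
      PrimeLatFilterOver.ext (Set.ext fun y => ⟨fun hy => ?_, fun hy => ?_⟩)⟩
    · by_contra hyP
      have hy : p.ev.toFun x < p.ev.toFun y := hy
      rw [hx] at hy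
      exact hy.not_ge (s.le_max' _ (by simpa [s] using ⟨y, rfl, hyP⟩))
    · exact not_le.1 fun h => hxP (hP y x hy h)

theorem card_primeLatFilterOver (p : GenIndex k) :
    Nat.card (PrimeLatFilterOver p.primeFilter) = p.1 + 1 := by
  rw [← Nat.card_congr (Equiv.ofBijective _ p.bijective_cutFilter)]
  have h : Nat.card {j : StdChain p.1 // j ≠ ⊤} = p.1 + 1 := by
    rw [Nat.card_eq_fintype_card, Fintype.card_subtype_compl, Fintype.card_subtype_eq]
    exact congrArg (· - 1) (Fintype.card_fin _)
  rw [← h]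
  exact Nat.card_congr (Equiv.subtypeEquivRight fun j => lt_top_iff_ne_top)

end GenIndex

/-! ### Isomorphism of multisets of chains -/

namespace MCTop

/-- The number of chains with `n` elements. -/
noncomputable def profile (C : MCTop) (n : ℕ) : ℕ :=
  Nat.card {i : C.ι // Nat.card (C.chain i) = n}

/-- A monotone surjection of a finite chain onto itself is an automorphism, hence the identity. -/
theorem hom_eq_id {C : MCTop} (f : C ⟶ C) (h : Hom.idx f = fun i => i) : f = 𝟙 C := by
  obtain ⟨idx, map, mono, surj, top⟩ := f
  obtain rfl : idx = fun i => i := h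
  have hmap : map = fun _ x => x := by
    funext i x
    have hs : StrictMono (map i) :=
      (mono i).strictMono_of_injective (Finite.injective_iff_surjective.2 (surj i))
    exact DFunLike.congr_fun (Subsingleton.elim (hs.orderIsoOfSurjective _ (surj i))
      (OrderIso.refl _)) x
  subst hmap
  rfl

theorem exists_hom {C D : MCTop} (σ : C.ι → D.ι)
    (h : ∀ i, Nat.card (C.chain i) = Nat.card (D.chain (σ i))) :
    ∃ f : C ⟶ D, Hom.idx f = σ := by
  have e : ∀ i, Nonempty (C.chain i ≃o D.chain (σ i)) := fun i => by
    have := Fintype.ofFinite (C.chain i)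
    have := Fintype.ofFinite (D.chain (σ i))
    have h := h i
    rw [Nat.card_eq_fintype_card, Nat.card_eq_fintype_card] at h
    exact ⟨(Fintype.orderIsoFinOfCardEq _ h).symm.trans (Fintype.orderIsoFinOfCardEq _ rfl)⟩
  replace e := fun i => Classical.choice (e i)
  exact ⟨⟨σ, fun i => e i, fun i => (e i).monotone, fun i => (e i).surjective,
    fun i _ => Set.ext fun x => by
      simp only [Set.mem_preimage, Set.mem_ofPred_eq, IsTop, (e i).surjective.forall,
        (e i).le_iff_le]⟩, rfl⟩

theorem iso_of_equiv {C D : MCTop} (σ : C.ι ≃ D.ι)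
    (h : ∀ i, Nat.card (C.chain i) = Nat.card (D.chain (σ i))) : Nonempty (C ≅ D) := by
  obtain ⟨f, hf⟩ := exists_hom σ h
  obtain ⟨g, hg⟩ := exists_hom (C := D) (D := C) σ.symm fun j => by
    rw [h, σ.apply_symm_apply]
  refine ⟨⟨f, g, hom_eq_id _ (funext fun i => ?_), hom_eq_id _ (funext fun j => ?_)⟩⟩
  · change Hom.idx g (Hom.idx f i) = i
    rw [hf, hg, σ.symm_apply_apply]
  · change Hom.idx f (Hom.idx g j) = j
    rw [hf, hg, σ.apply_symm_apply]

/-- Multisets of chains with as many chains of each size are isomorphic. -/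
theorem iso_of_profile {C D : MCTop} (h : ∀ n, C.profile n = D.profile n) :
    Nonempty (C ≅ D) := by
  have e := fun n => Classical.choice (Finite.card_eq.1 (h n))
  refine iso_of_equiv (Equiv.ofFiberEquiv (f := fun i => Nat.card (C.chain i))
    (g := fun j => Nat.card (D.chain j)) e) fun i => ?_
  exact (Equiv.ofFiberEquiv_map e i).symm

theorem profile_congr {C : MCTop} {κ : Type} (σ : κ → C.ι) (hσ : Function.Bijective σ) (n : ℕ) :
    C.profile n = Nat.card {i : κ // Nat.card (C.chain (σ i)) = n} :=
  (Nat.card_congr ((Equiv.ofBijective σ hσ).subtypeEquiv fun _ => Iff.rfl)).symm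

theorem profile_single (m : ℕ) (hm : 0 < m) (n : ℕ) :
    (single m hm).profile n = if n = m then 1 else 0 := by
  have h : ∀ i : (single m hm).ι, Nat.card ((single m hm).chain i) = m := fun _ =>
    Nat.card_fin m
  simp only [profile, h]
  split_ifs with hn
  · subst hn
    exact (Nat.card_congr (Equiv.subtypeUnivEquiv fun _ => rfl)).trans
      (Nat.card_unique (α := Unit))
  · have : IsEmpty {i : (single m hm).ι // m = n} := ⟨fun i => hn i.2.symm⟩
    exact Nat.card_of_isEmpty

theorem profile_union (C D : MCTop) (n : ℕ) :
    (C.union D).profile n = C.profile n + D.profile n := by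
  rw [profile, profile, profile, ← Nat.card_sum]
  exact Nat.card_congr (Equiv.subtypeSum (α := C.ι) (β := D.ι))

theorem profile_copower (N : ℕ) (C : MCTop) (n : ℕ) :
    (copower N C).profile n = N * C.profile n := by
  have h := Nat.card_prod (Fin N) {i : C.ι // Nat.card (C.chain i) = n}
  rw [Nat.card_fin] at h
  rw [profile, profile, ← h]
  exact Nat.card_congr ⟨fun p => (p.1.1, ⟨p.1.2, p.2⟩), fun p => ⟨(p.1, p.2.1), p.2.2⟩,
    fun _ => rfl, fun _ => rfl⟩

theorem profile_biUnion (s : Finset ℕ) (C : ∀ h ∈ s, MCTop) (n : ℕ) :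
    (biUnion s C).profile n = ∑ h : {h // h ∈ s}, (C h.1 h.2).profile n := by
  simp only [profile]
  rw [← Nat.card_sigma]
  exact Nat.card_congr ⟨fun p => ⟨p.1.1, ⟨p.1.2, p.2⟩⟩, fun p => ⟨⟨p.1, p.2.1⟩, p.2.2⟩,
    fun _ => rfl, fun _ => rfl⟩

end MCTop

/-! ### Counting generating assignments -/

namespace StdChain

/-- The number of generating assignments of `k` variables in the chain with `n + 2` elements. -/
noncomputable def numGenerates (k n : ℕ) : ℕ :=
  Nat.card {w : Fin k → StdChain n // Generates w}

theorem card_eq (n : ℕ) : Fintype.card (StdChain n) = n + 2 := Fintype.card_fin _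

/-- In the two-element chain the coatom is `⊥`, and both generation conditions are vacuous. -/
theorem numGenerates_zero (k : ℕ) : numGenerates k 0 = 2 ^ k := by
  have h : ∀ w : Fin k → StdChain 0, Generates w := fun w =>
    ⟨fun j _ hj => absurd (pos_of_lt hj coatom_lt) (lt_irrefl 0), fun h => absurd h (lt_irrefl 0)⟩
  rw [numGenerates, Nat.card_congr (Equiv.subtypeUnivEquiv h), Nat.card_eq_fintype_card,
    Fintype.card_fun, card_eq, Fintype.card_fin]

/-- Only the coatom is intermediate, so exactly the assignments into `{⊥, ⊤}` fail to generate. -/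
theorem numGenerates_one (k : ℕ) : numGenerates k 1 = 3 ^ k - 2 ^ k := by
  classical
  have h : ∀ w : Fin k → StdChain 1, Generates w ↔ ¬ ∀ a, w a ∈ ({⊥, ⊤} : Finset (StdChain 1)) :=
    fun w => by
      have hj : ∀ j : StdChain 1, ⊥ < j → ¬ j < coatom 1 := fun j h0 h1 => by
        rw [lt_iff, rank_coatom] at h1
        rw [lt_iff] at h0
        omega
      simp only [Generates, Finset.mem_insert, Finset.mem_singleton, not_forall, not_or,
        bot_lt_iff_ne_bot, lt_top_iff_ne_top]
      exact ⟨fun h => h.2 one_pos, fun h => ⟨fun j h0 h1 => absurd h1 (hj j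
        (bot_lt_iff_ne_bot.2 h0)), fun _ => h⟩⟩
  have h2 : Fintype.card {w : Fin k → StdChain 1 // ∀ a, w a ∈ ({⊥, ⊤} : Finset (StdChain 1))}
      = 2 ^ k := by
    rw [Fintype.card_congr (Equiv.subtypePiEquivPi (p := fun _ x =>
      x ∈ ({⊥, ⊤} : Finset (StdChain 1)))), Fintype.card_fun, Fintype.card_coe,
      Finset.card_pair bot_lt_top.ne, Fintype.card_fin]
  rw [numGenerates, Nat.card_congr (Equiv.subtypeEquivRight h), Nat.card_eq_fintype_card,
    Fintype.card_subtype_compl, h2, Fintype.card_fun, card_eq, Fintype.card_fin]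

theorem generates_iff {k n : ℕ} (hn : 2 ≤ n) (w : Fin k → StdChain n) :
    Generates w ↔ ∀ j ∈ Finset.univ.filter (fun j : StdChain n => ⊥ < j ∧ j < coatom n),
      ∃ a, w a = j := by
  simp only [Finset.mem_filter, Finset.mem_univ, true_and, and_imp]
  refine ⟨fun h => h.1, fun h => ⟨h, fun _ => ?_⟩⟩
  -- For `n ≥ 2` the atom lies below the coatom; being covered, it supplies the intermediate value.
  let j : StdChain n := (⟨1, by omega⟩ : Fin (n + 2))
  have h0 : ⊥ < j := show 0 < 1 from one_pos
  have h1 : j < coatom n := show 1 < n by omega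
  obtain ⟨a, ha⟩ := h j h0 h1
  exact ⟨a, ha ▸ h0, ha ▸ h1.trans coatom_lt⟩

/-- The number of functions whose range covers `T`. -/
theorem _root_.card_fun_covering (k : ℕ) {X : Type} [Fintype X] [DecidableEq X] (T : Finset X) :
    (Nat.card {w : Fin k → X // ∀ j ∈ T, ∃ a, w a = j} : ℤ) =
      ∑ i ∈ Finset.range (T.card + 1),
        (-1) ^ i * (T.card.choose i : ℤ) * ((Fintype.card X : ℤ) - i) ^ k := by
  -- Inclusion-exclusion over the functions that miss `j`; missing all of `t` means mapping into
  -- `tᶜ`.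
  let S : X → Finset (Fin k → X) := fun j => Finset.univ.filter fun w => ∀ a, w a ≠ j
  have hS : ∀ t : Finset X, ((t.inf S).card : ℤ) = ((Fintype.card X : ℤ) - t.card) ^ k :=
    fun t => by
      have : t.inf S = Fintype.piFinset fun _ => tᶜ := by
        ext w
        simp only [Finset.mem_inf, S, Finset.mem_filter, Finset.mem_univ, true_and,
          Fintype.mem_piFinset, Finset.mem_compl]
        exact ⟨fun h a ha => h _ ha a rfl, fun h j hj a ha => h a (ha ▸ hj)⟩
      rw [this, Fintype.card_piFinset_const, Finset.card_compl, Nat.cast_pow,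
        Nat.cast_sub (Finset.card_le_univ t)]
  have h1 : Nat.card {w : Fin k → X // ∀ j ∈ T, ∃ a, w a = j} =
      (T.inf fun j => (S j)ᶜ).card := by
    rw [Nat.card_eq_fintype_card, Fintype.card_subtype]
    congr 1
    ext w
    simp [Finset.mem_inf, S]
  rw [h1, Finset.inclusion_exclusion_card_inf_compl]
  simp only [hS]
  rw [Finset.sum_powerset_apply_card
    (f := fun i : ℕ => (-1 : ℤ) ^ i * ((Fintype.card X : ℤ) - i) ^ k)]
  refine Finset.sum_congr rfl fun i _ => ?_
  rw [nsmul_eq_mul]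
  ring

/-- With `h = n + 1`, there are `h - 2` elements to cover in a chain of `h + 1` elements. -/
theorem numGenerates_eq (k : ℕ) {n : ℕ} (hn : 2 ≤ n) :
    (numGenerates k n : ℤ) = chainCoeff k (n + 1) := by
  have hT : (Finset.univ.filter fun j : StdChain n => ⊥ < j ∧ j < coatom n).card = n - 1 := by
    have : (Finset.Ioo (0 : Fin (n + 2)) (⟨n, by omega⟩ : Fin (n + 2))).card = n - 1 := by
      rw [Fin.card_Ioo]; simp
    rw [← this]
    congr 1
    ext j
    exact (Finset.mem_filter.trans (and_iff_right (Finset.mem_univ j))).trans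
      (Finset.mem_Ioo (α := Fin (n + 2))).symm
  rw [numGenerates, Nat.card_congr (Equiv.subtypeEquivRight (generates_iff hn)),
    card_fun_covering, hT, card_eq, chainCoeff]
  refine Finset.sum_congr rfl fun i _ => ?_
  rw [show n + 1 - 2 = n - 1 by omega]
  push_cast
  ring

end StdChain

/-! ### The dual and the cardinality of the free algebra -/

namespace GenIndex

variable {k : ℕ}

theorem card_fst_eq (i : Fin (k + 2)) :
    Nat.card {p : GenIndex k // p.1 = i} = StdChain.numGenerates k i :=
  Nat.card_congr (Equiv.sigmaSubtype i)

theorem profile_dual (hfin : Finite (FreeDP (Fin k))) (n : ℕ) :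
    (MC.obj (Opposite.op (freeAlg k hfin))).profile n =
      if 1 ≤ n ∧ n ≤ k + 2 then StdChain.numGenerates k (n - 1) else 0 := by
  have h := MCTop.profile_congr (C := MC.obj (Opposite.op (freeAlg k hfin)))
    (primeFilter (k := k)) bijective_primeFilter n
  refine h.trans ?_
  have hc : ∀ p : GenIndex k, Nat.card ((MC.obj (Opposite.op (freeAlg k hfin))).chain
      p.primeFilter) = p.1 + 1 := card_primeLatFilterOver
  simp only [hc]
  split_ifs with hn
  · rw [← card_fst_eq ⟨n - 1, by omega⟩]
    refine Nat.card_congr (Equiv.subtypeEquivRight fun p => ?_)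
    rw [Fin.ext_iff]
    simp only
    omega
  · have : IsEmpty {p : GenIndex k // (p.1 : ℕ) + 1 = n} :=
      ⟨fun p => hn (by have := p.2; have := p.1.1.2; omega)⟩
    exact Nat.card_of_isEmpty

theorem card_freeDP (k : ℕ) :
    Nat.card (FreeDP (Fin k)) =
      ∏ i ∈ Finset.range (k + 2), (i + 2) ^ StdChain.numGenerates k i := by
  rw [Nat.card_congr (Equiv.ofBijective _ (bijective_ev (k := k))), Nat.card_pi]
  have h : ∀ p : GenIndex k, Nat.card (StdChain p.1) = p.1 + 2 := fun p => Nat.card_fin _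
  simp only [h]
  rw [Fintype.prod_sigma, ← Fin.prod_univ_eq_prod_range
    (fun i => (i + 2) ^ StdChain.numGenerates k i)]
  refine Finset.prod_congr rfl fun i _ => ?_
  simp only [Finset.prod_const, Finset.card_univ]
  rw [← Nat.card_eq_fintype_card]
  rfl

end GenIndex

theorem toNat_chainCoeff (k : ℕ) {h : ℕ} (hh : 3 ≤ h) :
    (chainCoeff k h).toNat = StdChain.numGenerates k (h - 1) := by
  have := StdChain.numGenerates_eq k (n := h - 1) (by omega)
  rw [Nat.sub_add_cancel (by omega)] at this
  rw [← this, Int.toNat_natCast]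

theorem iso_dual_freeAlg (k : ℕ) (hfin : Finite (FreeDP (Fin k))) :
    Nonempty (MC.obj (Opposite.op (freeAlg k hfin)) ≅
      ((MCTop.copower (2 ^ k) (MCTop.single 1 (by decide))).union
        (MCTop.copower (3 ^ k - 2 ^ k) (MCTop.single 2 (by decide)))).union
      (MCTop.biUnion (Finset.Icc 3 (k + 2)) fun h hh =>
        MCTop.copower (chainCoeff k h).toNat
          (MCTop.single h (lt_of_lt_of_le (by decide) (Finset.mem_Icc.1 hh).1)))) := by
  refine MCTop.iso_of_profile fun n => ?_
  rw [GenIndex.profile_dual]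
  simp only [MCTop.profile_union, MCTop.profile_copower, MCTop.profile_single,
    MCTop.profile_biUnion]
  rw [Finset.sum_coe_sort (Finset.Icc 3 (k + 2))
    (fun h => (chainCoeff k h).toNat * if n = h then 1 else 0)]
  simp only [mul_ite, mul_one, mul_zero, Finset.sum_ite_eq, Finset.mem_Icc]
  match n with
  | 0 => simp
  | 1 => simp [StdChain.numGenerates_zero]
  | 2 => simp [StdChain.numGenerates_one]
  | n + 3 => simp [toNat_chainCoeff]

theorem card_freeDP_eq (k : ℕ) :
    Nat.card (FreeDP (Fin k)) = 2 ^ (2 ^ k) * 3 ^ (3 ^ k - 2 ^ k) *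
      ∏ h ∈ Finset.Icc 3 (k + 2), (h + 1) ^ (chainCoeff k h).toNat := by
  rw [GenIndex.card_freeDP, Finset.prod_range_succ', Finset.prod_range_succ',
    StdChain.numGenerates_zero, StdChain.numGenerates_one, mul_assoc, mul_comm,
    mul_comm ((0 + 1 + 2) ^ _)]
  congr 1
  -- With the two smallest kinds of factors split off, the remaining index `i` corresponds to `h = i
  -- + 3`, a factor of `i + 4 = h + 1` elements.
  have h : Finset.Icc 3 (k + 2) = (Finset.range k).map (addRightEmbedding 3) := by
    rw [Finset.range_eq_Ico, Finset.map_add_right_Ico]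
    ext; simp; omega
  rw [h, Finset.prod_map]
  refine Finset.prod_congr rfl fun i _ => ?_
  rw [addRightEmbedding_apply, toNat_chainCoeff k (by omega)]
  rfl

theorem chainCoeff_one_three : (chainCoeff 1 3).toNat = 1 := by decide

theorem theorem5p4 :
    (∃ hfin : Finite (FreeDP (Fin 1)),
      Nonempty (MC.obj (Opposite.op (freeAlg 1 hfin)) ≅
        (((MCTop.single 1 (by decide)).union (MCTop.single 3 (by decide))).union
          (MCTop.single 2 (by decide))).union (MCTop.single 1 (by decide))) ∧
      Nat.card (FreeDP (Fin 1)) = 2 ^ 2 * 3 * 4 ∧ Nat.card (FreeDP (Fin 1)) = 48) ∧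
    ∀ k : ℕ,
      (∀ h ∈ Finset.Icc 3 (k + 2), 0 ≤ chainCoeff k h) ∧
      ∃ hfin : Finite (FreeDP (Fin k)),
        Nonempty (MC.obj (Opposite.op (freeAlg k hfin)) ≅
          ((MCTop.copower (2 ^ k) (MCTop.single 1 (by decide))).union
            (MCTop.copower (3 ^ k - 2 ^ k) (MCTop.single 2 (by decide)))).union
          (MCTop.biUnion (Finset.Icc 3 (k + 2)) fun h hh =>
            MCTop.copower (chainCoeff k h).toNat
              (MCTop.single h (lt_of_lt_of_le (by decide) (Finset.mem_Icc.1 hh).1)))) ∧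
        Nat.card (FreeDP (Fin k)) =
          2 ^ (2 ^ k) * 3 ^ (3 ^ k - 2 ^ k) *
            ∏ h ∈ Finset.Icc 3 (k + 2), (h + 1) ^ (chainCoeff k h).toNat := by
  have hcard : Nat.card (FreeDP (Fin 1)) = 48 := by
    rw [card_freeDP_eq]
    norm_num [chainCoeff_one_three]
  refine ⟨⟨GenIndex.finite_freeDP 1, ?_, hcard, hcard⟩, fun k => ⟨fun h hh => ?_,
    GenIndex.finite_freeDP k, iso_dual_freeAlg k _, card_freeDP_eq k⟩⟩
  · refine MCTop.iso_of_profile fun n => ?_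
    rw [GenIndex.profile_dual]
    simp only [MCTop.profile_union, MCTop.profile_single]
    match n with
    | 0 => simp
    | 1 => simp [StdChain.numGenerates_zero]
    | 2 => simp [StdChain.numGenerates_one]
    | 3 => simp [← toNat_chainCoeff 1 le_rfl, chainCoeff_one_three]
    | n + 4 => simp
  -- The alternating sum is nonnegative because it counts generating assignments.
  · have hn := (Finset.mem_Icc.1 hh).1
    have := StdChain.numGenerates_eq k (n := h - 1) (by omega)
    rw [Nat.sub_add_cancel (by omega)] at this
    exact this ▸ Int.natCast_nonneg _
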